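/- Conventions. Let $\mathbb{N}=\{1,2,\dots\}$. For a nonempty set $S\subseteq\mathbb{N}$, finite or infinite, $S(k)$ denotes its $k$-th element in increasing order; $t\sqsubseteq s$ (resp. $t\sqsubset s$) means that $t$ is an initial (resp. proper initial) segment of $s$. For a family $\mathcal F$ of finite subsets of $\mathbb{N}$ put $\widehat{\mathcal F}=\{t:\ t\sqsubseteq s\text{ for some }s\in\mathcal F\}$. The family $\mathcal F$ is *thin* if there are no $s,t\in\mathcal F$ with $s\sqsubset t$. It is *regular* if it is hereditary (closed under subsets), compact ($\{\chi_s:s\in\mathcal F\}$ is closed in $\{0,1\}^{\mathbb N}$) and spreading (if $\{n_1<\dots<n_k\}\in\mathcal F$ and $m_1<\dots<m_k$ with $n_i\le m_i$ for all $i$, then $\{m_1,\dots,m_k\}\in\mathcal F$). It is *regular thin* if it is thin and $\widehat{\mathcal F}$ is regular. The *order* $o(\mathcal F)$ of a nonempty family $\mathcal F$ is $o_{\widehat{\mathcal F}}(\varnothing)$, where $o_{\widehat{\mathcal F}}(s)=\sup\{o_{\widehat{\mathcal F}}(t)+1:\ t\in\widehat{\mathcal F},\ s\sqsubset t\}$ (and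 $\sup\varnothing=0$), if the tree $(\widehat{\mathcal F},\sqsubset)$ has no infinite strictly increasing sequence; otherwise $o(\mathcal F)=\omega_1$. A tuple $(s_j)_{j=1}^l$ of nonempty finite subsets of $\mathbb{N}$ is a *plegma family* if $s_i(k)<s_j(k)$ whenever $i<j$ and $1\le k\le\min(|s_i|,|s_j|)$, and $s_i(k)<s_j(k+1)$ for all $i,j$ and all $1\le k\le\min(|s_i|,|s_j|-1)$. Let $X$ be a real Banach space and $\mathcal F$ a regular thin family. An *$\mathcal F$-sequence* in $X$ is a family $(x_s)_{s\in\mathcal F}$ of elements of $X$. Let $(e_n)_n$ be a Hamel basis of a seminormed real vector space $(E,\|\cdot\|_*)$. The $\mathcal F$-sequence $(x_s)_{s\in\mathcal F}$ *admits $(e_n)_n$ as an $\mathcal F$-spreading model* if there are an infinite $M\subseteq\mathbb{N}$ and a null sequence $(\delta_n)_n$ of positive reals such that $$\Bigg|\Big\|\sum_{j=1}^k a_jx_{s_j}\Big\|-\Big\|\sum_{j=1}^k a_je_j\Big\|_*\Bigg|\le\delta_l$$ for all $1\le k\le l$, all $a_1,\dots,a_k\in[-1,1]$ and all plegma families $(s_j)_{j=1}^k$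 of members of $\mathcal F$ that are subsets of $M$ with $s_1(1)\ge M(l)$. For $A\subseteq X$, $(e_n)_n$ is an *$\mathcal F$-spreading model of $A$* if some $\mathcal F$-sequence with all terms in $A$ admits it. For a countable ordinal $\xi\ge1$, $\mathcal{SM}_\xi(A)$ is the class of all $(e_n)_n$ that are an $\mathcal F$-spreading model of $A$ for some regular thin family $\mathcal F$ with $o(\mathcal F)=\xi$. Statement. Let $X$ be a real Banach space. 1. Let $\mathcal F,\mathcal G$ be nonempty regular thin families with $1\le o(\mathcal F)\le o(\mathcal G)$, and let $(x_s)_{s\in\mathcal F}$ be an $\mathcal F$-sequence in $X$ which admits $(e_n)_n$ as an $\mathcal F$-spreading model. Then there is a $\mathcal G$-sequence $(w_t)_{t\in\mathcal G}$ with $\{w_t:t\in\mathcal G\}\subseteq\{x_s:s\in\mathcal F\}$ which admits $(e_n)_n$ as a $\mathcal G$-spreading model. 2. Let $A\subseteq X$ and let $\mathcal F,\mathcal G$ be nonempty regular thin families with $o(\mathcal F)=o(\mathcal G)$. Then $(e_n)_n$ is an $\mathcal F$-spreading model of $A$ if and only if it is a $\mathcal G$-spreading model of $A$. 3. For every $A\subseteq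 X$ and all ordinals $1\le\zeta<\xi<\omega_1$ we have $\mathcal{SM}_\zeta(A)\subseteq\mathcal{SM}_\xi(A)$. -/

import Mathlib

open Filter Topology

universe u v

noncomputable section

namespace PlegmaSpreading

/-! Families of finite subsets of `ℕ` are sets `F : Set (Finset ℕ)`; infinite subsets of `ℕ` are
`M : Set ℕ` with `M.Infinite`. Every notion below depends on `ℕ` only as a linear order of type
`ω`, so it makes no difference whether the least natural number is called `0` or `1`. -/

/-- `t ⊑ s`: `t` is an initial segment of `s`. -/
def IsInitial (t s : Finset ℕ) : Prop :=
  t ⊆ s ∧ ∀ a ∈ s, ∀ b ∈ t, a ≤ b → a ∈ t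

/-- `t ⊏ s`: `t` is a proper initial segment of `s`. -/
def IsProperInitial (t s : Finset ℕ) : Prop :=
  IsInitial t s ∧ t ≠ s

/-- The `⊑`-closure `F̂` of a family `F`. -/
def hat (F : Set (Finset ℕ)) : Set (Finset ℕ) :=
  {t | ∃ s ∈ F, IsInitial t s}

/-- `Extends F t s`: `t` is a member of the tree `F̂` that properly extends `s`
(then `s` is in `F̂` as well). -/
def Extends (F : Set (Finset ℕ)) (t s : Finset ℕ) : Prop :=
  t ∈ hat F ∧ IsProperInitial s t

open Classical in
/-- The order `o(F)` of a nonempty family `F`. If the tree `F̂` is well-founded, it is the rank of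
`∅`, where the rank of `s` is the supremum of `rank t + 1` over all proper extensions `t` of `s`
in `F̂` (so it is `0` at the maximal elements); otherwise it is `ω₁`. -/
def familyOrder (F : Set (Finset ℕ)) : Ordinal.{0} :=
  if h : WellFounded (Extends F) then (h.apply ∅).rank else Ordinal.omega 1

/-- Hereditary families. -/
def IsHereditary (R : Set (Finset ℕ)) : Prop :=
  ∀ s ∈ R, ∀ t, t ⊆ s → t ∈ R

/-- Spreading families: if `n₁ < ⋯ < nₖ`, `m₁ < ⋯ < mₖ`, `nᵢ ≤ mᵢ` for all `i`, and
`{n₁, …, nₖ}` is in `R`, then `{m₁, …, mₖ}` is in `R`. -/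
def IsSpreading (R : Set (Finset ℕ)) : Prop :=
  ∀ (k : ℕ) (n m : Fin k → ℕ), StrictMono n → StrictMono m → (∀ i, n i ≤ m i) →
    Finset.univ.image n ∈ R → Finset.univ.image m ∈ R

/-- Compact families: the characteristic functions of the members form a closed subset of
`{0,1}^ℕ` in the product topology. -/
def IsCompactFamily (R : Set (Finset ℕ)) : Prop :=
  IsClosed ((fun (s : Finset ℕ) (n : ℕ) => decide (n ∈ s)) '' R : Set (ℕ → Bool))

/-- Regular families. -/
def IsRegular (R : Set (Finset ℕ)) : Prop :=
  IsCompactFamily R ∧ IsHereditary R ∧ IsSpreading R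

/-- Thin families: no member is a proper initial segment of another one. -/
def IsThin (F : Set (Finset ℕ)) : Prop :=
  ∀ s ∈ F, ∀ t ∈ F, ¬ IsProperInitial s t

/-- Regular thin families. -/
def IsRegularThin (F : Set (Finset ℕ)) : Prop :=
  IsThin F ∧ IsRegular (hat F)

/-- For a finite or infinite set `S` of natural numbers and `k ≥ 1` (with `k ≤ |S|` if `S` is
finite), `elt S k` is the `k`-th element `S(k)` of `S` in increasing order. -/
def elt (S : Set ℕ) (k : ℕ) : ℕ :=
  Nat.nth (fun n => n ∈ S) (k - 1)

/-- Plegma families `(s₁, …, s_l)`. -/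
def IsPlegma {l : ℕ} (s : Fin l → Finset ℕ) : Prop :=
  (∀ i, (s i).Nonempty) ∧
  (∀ i j, i < j → ∀ k, 1 ≤ k → k ≤ (s i).card → k ≤ (s j).card →
    elt ↑(s i) k < elt ↑(s j) k) ∧
  (∀ i j, ∀ k, 1 ≤ k → k ≤ (s i).card → k + 1 ≤ (s j).card →
    elt ↑(s i) k < elt ↑(s j) (k + 1))

section SpreadingModels

variable {X : Type u} [NormedAddCommGroup X] [NormedSpace ℝ X]
  {E : Type v} [SeminormedAddCommGroup E] [NormedSpace ℝ E]

/-- The `F`-subsequence `(x_s)_{s ∈ F ↾ M}` of the `F`-sequence `x : F → X` generates the Hamel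
basis `e` of the seminormed space `E` as an `F`-spreading model with respect to `δ`. For `1 ≤ k`
the condition `s₁(1) ≥ M(l)` says that every element of `s₁` is at least `M(l)`. The sequences
`s₁, …, s_k`, `a₁, …, a_k` and `e₁, e₂, …` are enumerated from `0` here, while `δ_l` and `M(l)`
are indexed by `l ≥ 1`. -/
def Generates {F : Set (Finset ℕ)} (x : F → X) (M : Set ℕ) (δ : ℕ → ℝ)
    (e : Module.Basis ℕ ℝ E) : Prop :=
  ∀ (l k : ℕ) (hk : 1 ≤ k), k ≤ l → ∀ (a : Fin k → ℝ), (∀ j, a j ∈ Set.Icc (-1 : ℝ) 1) →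
    ∀ (s : Fin k → F), (∀ j, ((s j : Finset ℕ) : Set ℕ) ⊆ M) →
      IsPlegma (fun j => (s j : Finset ℕ)) →
      (∀ n ∈ (s ⟨0, hk⟩ : Finset ℕ), elt M l ≤ n) →
      |‖∑ j, a j • x (s j)‖ - ‖∑ j, a j • e (j : ℕ)‖| ≤ δ l

/-- The `F`-sequence `x` admits `e` as an `F`-spreading model: for some infinite `M`, the
subsequence `(x_s)_{s ∈ F ↾ M}` generates `e` with respect to some null sequence of positive
reals. -/
def Admits {F : Set (Finset ℕ)} (x : F → X) (e : Module.Basis ℕ ℝ E) : Prop :=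
  ∃ M : Set ℕ, M.Infinite ∧ ∃ δ : ℕ → ℝ, (∀ n, 0 < δ n) ∧ Tendsto δ atTop (𝓝 0) ∧
    Generates x M δ e

/-- `e` is an `F`-spreading model of the subset `A` of `X`: some `F`-sequence in `A` admits it. -/
def IsSpreadingModelOf (F : Set (Finset ℕ)) (A : Set X) (e : Module.Basis ℕ ℝ E) : Prop :=
  ∃ x : F → X, (∀ s, x s ∈ A) ∧ Admits x e

end SpreadingModels

/-- A seminormed real vector space together with a Hamel basis `(e_n)` indexed by `ℕ`; these are
the objects that can be spreading models. -/
structure BasisSequence : Type (v + 1) where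
  carrier : Type v
  [seminormed : SeminormedAddCommGroup carrier]
  [normedSpace : NormedSpace ℝ carrier]
  basis : Module.Basis ℕ ℝ carrier

attribute [instance] BasisSequence.seminormed BasisSequence.normedSpace

/-- `SM_ξ(A)`: all `ξ`-spreading models of `A`, i.e. all `F`-spreading models of `A` for some
regular thin family `F` of order `ξ`. -/
def SM {X : Type u} [NormedAddCommGroup X] [NormedSpace ℝ X] (ξ : Ordinal.{0}) (A : Set X) :
    Set BasisSequence.{v} :=
  {e | ∃ F : Set (Finset ℕ), IsRegularThin F ∧ familyOrder F = ξ ∧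
    IsSpreadingModelOf F A e.basis}

end PlegmaSpreading

end

open PlegmaSpreading

/-!
The theorem rests on a comparison of trees: if `F` and `G` are regular thin with `o(F) ≤ o(G)`, there
is a strictly increasing `L : ℕ → ℕ` such that `L(u) ∈ Ĝ` for all `u ∈ F̂`
(`exists_strictMono_image_mem_hat`). It is built by well-founded induction on `F̂`: for each possible
next element `n`, the inequality of ranks provides a one-point extension in `Ĝ` and, inductively, a
map `L n` that works beyond it; a single map dominating all the `L n` from `n` on works for all of
them at once, since `Ĝ` is spreading.

Given `L`, and a spreading model of `(x_s)` generated along `M`, pass to an infinite `M' ⊆ M` so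
sparse that each finite subset of `M'` either lies in `F̂` or has an initial segment in `F`
(`exists_infinite_subset_forall_mem_hat_or_exists_isInitial`). For `t ∈ G` with `t ⊆ L(M')`, thinness
of `G` then gives a `p ∈ F` whose image `L(p)` is an initial segment of `t`; put `w_t = x_p`. Initial
segments and preimages under `L` of plegma families are plegma, so `w` admits the same spreading model
along `L(M')`.

The equivalence for families of equal order follows by applying this in both directions, except for
order `0`, where both families are `{∅}`. The inclusion of the classes `SM` also needs a regular thin
family of each order `ξ < ω₁` (`exists_isRegularThin_familyOrder_eq`). With an injection `code` of `ξ`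
into `ℕ`, take the finite sets `{n₁ < ⋯ < nₖ}` for which there are ordinals `ξ > α₁ > ⋯ > αₖ` with
`code αᵢ ≤ nᵢ`. Only finitely many choices of `αₖ` are possible, and the largest of them is the rank
of the set; hence the family is well-founded of rank `ξ`, and its maximal members are as required.
-/

namespace PlegmaSpreading

/-! ### Initial segments and spreading families -/

lemma IsInitial.refl (s : Finset ℕ) : IsInitial s s :=
  ⟨subset_rfl, fun _ ha _ _ _ => ha⟩

lemma empty_isInitial (s : Finset ℕ) : IsInitial ∅ s :=
  ⟨Finset.empty_subset s, fun _ _ _ hb => absurd hb (Finset.notMem_empty _)⟩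

lemma IsInitial.trans {s t u : Finset ℕ} (h₁ : IsInitial s t) (h₂ : IsInitial t u) :
    IsInitial s u :=
  ⟨h₁.1.trans h₂.1, fun a ha b hb hab => h₁.2 a (h₂.2 a ha b (h₁.1 hb) hab) b hb hab⟩

lemma IsInitial.image {s t : Finset ℕ} {L : ℕ → ℕ} (hL : StrictMono L) (h : IsInitial s t) :
    IsInitial (s.image L) (t.image L) := by
  refine ⟨Finset.image_subset_image h.1, ?_⟩
  simp only [Finset.mem_image]
  rintro _ ⟨a, ha, rfl⟩ _ ⟨b, hb, rfl⟩ hab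
  exact ⟨a, h.2 a ha b hb (hL.le_iff_le.1 hab), rfl⟩

lemma isProperInitial_insert {s : Finset ℕ} {n : ℕ} (h : ∀ j ∈ s, j < n) :
    IsProperInitial s (insert n s) := by
  refine ⟨⟨Finset.subset_insert n s, fun a ha b hb hab => ?_⟩, fun he => ?_⟩
  · rcases Finset.mem_insert.1 ha with rfl | ha
    · exact absurd (h b hb) (not_lt.2 hab)
    · exact ha
  · exact lt_irrefl n (h n (he ▸ Finset.mem_insert_self n s))

lemma IsProperInitial.exists_insert {s u : Finset ℕ} (h : IsProperInitial s u) :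
    ∃ n ∈ u, (∀ j ∈ s, j < n) ∧ IsInitial (insert n s) u := by
  have hne : (u \ s).Nonempty :=
    Finset.sdiff_nonempty.2 fun hus => h.2 (h.1.1.antisymm hus)
  obtain ⟨hu, hs⟩ := Finset.mem_sdiff.1 ((u \ s).min'_mem hne)
  refine ⟨_, hu, fun j hj => ?_, Finset.insert_subset hu h.1.1, fun a ha b hb hab => ?_⟩
  · exact not_le.1 fun hle => hs (h.1.2 _ hu j hj hle)
  · by_cases has : a ∈ s
    · exact Finset.mem_insert_of_mem has
    · rcases Finset.mem_insert.1 hb with rfl | hb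
      · have := (u \ s).min'_le a (Finset.mem_sdiff.2 ⟨ha, has⟩)
        exact Finset.mem_insert.2 (Or.inl (le_antisymm hab this))
      · exact absurd (h.1.2 a ha b hb hab) has

lemma subset_hat (F : Set (Finset ℕ)) : F ⊆ hat F := fun s hs => ⟨s, hs, .refl s⟩

lemma mem_hat_of_isInitial {F : Set (Finset ℕ)} {s t : Finset ℕ} (ht : t ∈ hat F)
    (h : IsInitial s t) : s ∈ hat F := by
  obtain ⟨u, hu, htu⟩ := ht
  exact ⟨u, hu, h.trans htu⟩

lemma IsThin.eq_of_isInitial {F : Set (Finset ℕ)} (hF : IsThin F) {s t : Finset ℕ} (hs : s ∈ F)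
    (ht : t ∈ F) (h : IsInitial s t) : s = t :=
  by_contra fun hne => hF s hs t ht ⟨h, hne⟩

lemma IsSpreading.image_mem {R : Set (Finset ℕ)} (hR : IsSpreading R) {u : Finset ℕ}
    {g h : ℕ → ℕ} (hg : StrictMonoOn g ↑u) (hh : StrictMonoOn h ↑u) (hgh : ∀ k ∈ u, g k ≤ h k)
    (hu : u.image g ∈ R) : u.image h ∈ R := by
  have key (f : ℕ → ℕ) : Finset.univ.image (f ∘ u.orderEmbOfFin rfl) = u.image f := by
    rw [← Finset.image_image, Finset.image_orderEmbOfFin_univ]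
  have hmem (i) : u.orderEmbOfFin rfl i ∈ u := u.orderEmbOfFin_mem rfl i
  rw [← key] at hu ⊢
  exact hR _ _ _
    (fun i j hij => hg (hmem i) (hmem j) ((u.orderEmbOfFin rfl).strictMono hij))
    (fun i j hij => hh (hmem i) (hmem j) ((u.orderEmbOfFin rfl).strictMono hij))
    (fun i => hgh _ (hmem i)) hu

lemma IsSpreading.insert_mem {R : Set (Finset ℕ)} (hR : IsSpreading R) {s : Finset ℕ} {a b : ℕ}
    (hs : ∀ j ∈ s, j < b) (hab : b ≤ a) (h : insert b s ∈ R) : insert a s ∈ R := by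
  have ha : a ∉ s := fun h => absurd (hs a h) (not_lt.2 hab)
  have hid : Set.EqOn (Function.update id a b) id ↑s := fun j hj =>
    Function.update_of_ne (ne_of_mem_of_not_mem hj ha) _ _
  have himg : (insert a s).image (Function.update id a b) = insert b s := by
    rw [Finset.image_insert, Function.update_self, Finset.image_congr hid, Finset.image_id]
  rw [← Finset.image_id (s := insert a s)]
  refine hR.image_mem (g := Function.update id a b) ?_ (strictMono_id.strictMonoOn _) ?_ (himg ▸ h)
  · intro i hi j hj hij
    simp only [Finset.coe_insert, Set.mem_insert_iff, Finset.mem_coe] at hi hj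
    rcases hi with rfl | hi <;> rcases hj with rfl | hj
    · exact absurd hij (lt_irrefl _)
    · exact absurd (hs j hj) (not_lt.2 (hab.trans hij.le))
    · rw [hid hi, Function.update_self]
      exact hs i hi
    · rw [hid hi, hid hj]
      exact hij
  · intro k hk
    rcases Finset.mem_insert.1 hk with rfl | hk
    · simpa using hab
    · exact (hid hk).le

/-! ### Well-foundedness and order -/

/-- A strictly increasing chain in `F̂` would converge to the characteristic function of an infinite
set, which compactness forbids. -/
lemma IsCompactFamily.wellFounded_extends {F : Set (Finset ℕ)} (hF : IsCompactFamily (hat F)) :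
    WellFounded (Extends F) := by
  classical
  rw [wellFounded_iff_isEmpty_descending_chain]
  refine ⟨fun ⟨f, hf⟩ => ?_⟩
  have hss : StrictMono f := strictMono_nat_of_lt_succ fun n =>
    Finset.ssubset_iff_subset_ne.2 ⟨(hf n).2.1.1, (hf n).2.2⟩
  have hlim : Tendsto (fun n (k : ℕ) => decide (k ∈ f (n + 1))) atTop
      (𝓝 fun k => decide (∃ n, k ∈ f n)) := by
    refine tendsto_pi_nhds.2 fun k => tendsto_const_nhds.congr' ?_
    by_cases hk : ∃ n, k ∈ f n
    · obtain ⟨n, hn⟩ := hk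
      filter_upwards [eventually_ge_atTop n] with m hm
      have : k ∈ f (m + 1) := hss.monotone (hm.trans m.le_succ) hn
      exact decide_eq_decide.2 ⟨fun _ => this, fun _ => ⟨n, hn⟩⟩
    · refine Eventually.of_forall fun m => ?_
      have : k ∉ f (m + 1) := fun h => hk ⟨_, h⟩
      exact decide_eq_decide.2 ⟨fun h => absurd h hk, fun h => absurd h this⟩
  obtain ⟨s, -, hs⟩ := hF.mem_of_tendsto hlim
    (Eventually.of_forall fun n => ⟨f (n + 1), (hf n).1, rfl⟩)
  have hsub (n) : f n ⊆ s := fun k hk => by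
    exact (decide_eq_decide.1 (congrFun hs k)).2 ⟨n, hk⟩
  have hcard : StrictMono fun n => (f n).card := Finset.card_strictMono.comp hss
  have h1 := hcard.le_apply (x := s.card + 1)
  have h2 := Finset.card_le_card (hsub (s.card + 1))
  omega

lemma familyOrder_eq_rank {F : Set (Finset ℕ)} (h : WellFounded (Extends F)) :
    familyOrder F = (h.apply ∅).rank := dif_pos h

lemma exists_rank_le_of_lt_rank {F : Set (Finset ℕ)} (h : WellFounded (Extends F)) {s : Finset ℕ}
    {α : Ordinal.{0}} (hα : α < (h.apply s).rank) :
    ∃ t, Extends F t s ∧ α ≤ (h.apply t).rank := by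
  rw [Acc.rank_eq] at hα
  obtain ⟨⟨t, ht⟩, hlt⟩ := (Ordinal.lt_iSup_iff).1 hα
  exact ⟨t, ht, Order.lt_succ_iff.1 hlt⟩

lemma rank_le_of_forall_lt {F : Set (Finset ℕ)} (h : WellFounded (Extends F)) {s : Finset ℕ}
    {α : Ordinal.{0}} (hα : ∀ t, Extends F t s → (h.apply t).rank < α) :
    (h.apply s).rank ≤ α := by
  rw [Acc.rank_eq]
  exact Ordinal.iSup_le fun t => Order.succ_le_of_lt (hα t t.2)

lemma rank_lt_rank {F : Set (Finset ℕ)} (h : WellFounded (Extends F)) {s t : Finset ℕ}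
    (hts : Extends F t s) : (h.apply t).rank < (h.apply s).rank :=
  Acc.rank_lt_of_rel (h.apply s) hts

/-- A thin family containing `∅` has order `0`, since it is `{∅}`; so is the order of the empty
family. -/
lemma nonempty_of_one_le_familyOrder {F : Set (Finset ℕ)} (hF : IsRegularThin F)
    (h : 1 ≤ familyOrder F) : F.Nonempty ∧ ∅ ∉ F := by
  have hwf := hF.2.1.wellFounded_extends
  rw [familyOrder_eq_rank hwf, Order.one_le_iff_pos] at h
  obtain ⟨t, ⟨⟨s, hs, hts⟩, -, hne⟩, -⟩ := exists_rank_le_of_lt_rank hwf h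
  refine ⟨⟨s, hs⟩, fun h0 => hne ?_⟩
  have := hF.1.eq_of_isInitial h0 hs (empty_isInitial s)
  subst this
  exact (Finset.subset_empty.1 hts.1).symm

lemma eq_singleton_of_familyOrder_eq_zero {F : Set (Finset ℕ)} (hF : IsRegularThin F)
    (hne : F.Nonempty) (h : familyOrder F = 0) : F = {∅} := by
  have hwf := hF.2.1.wellFounded_extends
  rw [familyOrder_eq_rank hwf] at h
  refine Set.eq_singleton_iff_nonempty_unique_mem.2 ⟨hne, fun s hs => by_contra fun hs0 => ?_⟩
  have := rank_lt_rank hwf (s := ∅) ⟨subset_hat F hs, empty_isInitial s, Ne.symm hs0⟩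
  rw [h] at this
  exact not_lt_zero this

/-! ### Embedding a tree of smaller order -/

/-- Well-founded induction on `s`. For each `n` such that `s ∪ {n}` lies in `F̂`, extend `f` to
`n` with `f(s ∪ {n})` in `Ĝ` of rank at least that of `s ∪ {n}`, and take a map `L n` which works
for `s ∪ {n}`. Any strictly increasing map which dominates `L n` from `n` on, for all `n`
simultaneously, works for `s`, because `Ĝ` is spreading. -/
theorem exists_strictMonoOn_image_mem_hat {F G : Set (Finset ℕ)} (hF : WellFounded (Extends F))
    (hG : WellFounded (Extends G)) (hs : IsSpreading (hat G)) (s : Finset ℕ) :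
    ∀ f : ℕ → ℕ, StrictMonoOn f ↑s → s.image f ∈ hat G →
      (hF.apply s).rank ≤ (hG.apply (s.image f)).rank →
      ∃ L : ℕ → ℕ, StrictMonoOn L {k | k ∈ s ∨ ∀ j ∈ s, j < k} ∧ (∀ k ∈ s, L k = f k) ∧
        ∀ u ∈ hat F, IsInitial s u → u.image L ∈ hat G := by
  induction s using hF.induction with
  | _ s ih =>
  intro f hf hfs hrank
  have step (n : ℕ) : ∃ L : ℕ → ℕ, (∀ j ∈ s, j < n) → insert n s ∈ hat F →
      StrictMonoOn L {k | k ∈ insert n s ∨ ∀ j ∈ insert n s, j < k} ∧ (∀ k ∈ s, L k = f k) ∧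
        ∀ u ∈ hat F, IsInitial (insert n s) u → u.image L ∈ hat G := by
    by_cases hn : (∀ j ∈ s, j < n) ∧ insert n s ∈ hat F
    swap
    · exact ⟨id, fun h₁ h₂ => absurd ⟨h₁, h₂⟩ hn⟩
    obtain ⟨hn, hnF⟩ := hn
    have hext : Extends F (insert n s) s := ⟨hnF, isProperInitial_insert hn⟩
    obtain ⟨t, ht, hrt⟩ := exists_rank_le_of_lt_rank hG ((rank_lt_rank hF hext).trans_le hrank)
    obtain ⟨m, -, hm, hmt⟩ := ht.2.exists_insert
    have hrm : (hG.apply t).rank ≤ (hG.apply (insert m (s.image f))).rank := by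
      by_cases heq : insert m (s.image f) = t
      · rw [heq]
      · exact (rank_lt_rank hG ⟨ht.1, hmt, heq⟩).le
    have hns : n ∉ s := fun h => lt_irrefl n (hn n h)
    have heq : Set.EqOn (Function.update f n m) f ↑s := fun j hj =>
      Function.update_of_ne (ne_of_mem_of_not_mem hj hns) _ _
    have himg : (insert n s).image (Function.update f n m) = insert m (s.image f) := by
      rw [Finset.image_insert, Function.update_self, Finset.image_congr heq]
    have hmono : StrictMonoOn (Function.update f n m) ↑(insert n s) := by
      intro i hi j hj hij
      simp only [Finset.coe_insert, Set.mem_insert_iff, Finset.mem_coe] at hi hj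
      rcases hi with rfl | hi <;> rcases hj with rfl | hj
      · exact absurd hij (lt_irrefl _)
      · exact absurd (hn j hj) (not_lt.2 hij.le)
      · rw [heq hi, Function.update_self]
        exact hm _ (Finset.mem_image_of_mem f hi)
      · rw [heq hi, heq hj]
        exact hf hi hj hij
    obtain ⟨L, hL, hLf, hLu⟩ := ih _ hext (Function.update f n m) hmono
      (himg ▸ mem_hat_of_isInitial ht.1 hmt) (by rw [himg]; exact hrt.trans hrm)
    exact ⟨L, fun _ _ => ⟨hL,
      fun k hk => (hLf k (Finset.mem_insert_of_mem hk)).trans (heq hk), hLu⟩⟩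
  choose L hL using step
  set B : ℕ → ℕ := fun k => (∑ n ∈ Finset.range (k + 1), L n k) + ∑ j ∈ s, f j with hB
  set D : ℕ → ℕ := fun k => ∑ i ∈ Finset.range (k + 1), (B i + 1) with hD
  have hDmono : StrictMono D := strictMono_nat_of_lt_succ fun k => by
    simp only [hD, Finset.sum_range_succ _ (k + 1)]
    omega
  have hBD (k) : B k < D k :=
    Nat.lt_of_succ_le (Finset.single_le_sum (f := fun i => B i + 1) (fun _ _ => Nat.zero_le _)
      (Finset.mem_range.2 k.lt_succ_self))
  have hLD {n k} (hnk : n ≤ k) : L n k ≤ D k := by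
    have : L n k ≤ ∑ n ∈ Finset.range (k + 1), L n k :=
      Finset.single_le_sum (f := fun n => L n k) (fun _ _ => Nat.zero_le _)
        (Finset.mem_range.2 (Nat.lt_succ_of_le hnk))
    have := hBD k
    simp only [hB] at this
    omega
  have hfD {j} (hj : j ∈ s) (k) : f j < D k := by
    have : f j ≤ ∑ j ∈ s, f j := Finset.single_le_sum (fun _ _ => Nat.zero_le _) hj
    have := hBD k
    simp only [hB] at this
    omega
  have hmono : StrictMonoOn (fun k => if k ∈ s then f k else D k)
      {k | k ∈ s ∨ ∀ j ∈ s, j < k} := by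
    intro a ha b hb hab
    by_cases has : a ∈ s <;> by_cases hbs : b ∈ s
    · simpa only [has, hbs, if_true] using hf has hbs hab
    · simpa only [has, hbs, if_true, if_false] using hfD has b
    · exact absurd ((ha.resolve_left has) b hbs) (not_lt.2 hab.le)
    · simpa only [has, hbs, if_false] using hDmono hab
  refine ⟨fun k => if k ∈ s then f k else D k, hmono, fun k hk => if_pos hk, fun u hu hsu => ?_⟩
  by_cases heq : s = u
  · subst heq
    have : Set.EqOn (fun k => if k ∈ s then f k else D k) f ↑s := fun k hk => if_pos hk
    rwa [Finset.image_congr this]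
  obtain ⟨n, -, hn, hnu⟩ := IsProperInitial.exists_insert ⟨hsu, heq⟩
  obtain ⟨hLmono, hLf, hLu⟩ := hL n hn (mem_hat_of_isInitial hu hnu)
  have above {t : Finset ℕ} (h : IsInitial t u) :
      (u : Set ℕ) ⊆ {k | k ∈ t ∨ ∀ j ∈ t, j < k} := fun k hk =>
    or_iff_not_imp_left.2 fun hkt j hj => not_le.1 fun hle => hkt (h.2 k hk j hj hle)
  refine hs.image_mem (hLmono.mono (above hnu)) (hmono.mono (above hsu)) (fun k hk => ?_)
    (hLu u hu hnu)
  by_cases hks : k ∈ s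
  · simp only [hks, if_true, hLf k hks, le_refl]
  · simp only [hks, if_false]
    refine hLD ?_
    rcases above hnu hk with h | h
    · rcases Finset.mem_insert.1 h with rfl | h
      · exact le_rfl
      · exact absurd h hks
    · exact (h n (Finset.mem_insert_self n s)).le

theorem exists_strictMono_image_mem_hat {F G : Set (Finset ℕ)} (hF : IsRegularThin F)
    (hG : IsRegularThin G) (hne : G.Nonempty) (h : familyOrder F ≤ familyOrder G) :
    ∃ L : ℕ → ℕ, StrictMono L ∧ ∀ u ∈ hat F, u.image L ∈ hat G := by
  have hwF := hF.2.1.wellFounded_extends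
  have hwG := hG.2.1.wellFounded_extends
  rw [familyOrder_eq_rank hwF, familyOrder_eq_rank hwG] at h
  obtain ⟨g, hg⟩ := hne
  obtain ⟨L, hL, -, hLu⟩ := exists_strictMonoOn_image_mem_hat hwF hwG hG.2.2.2 ∅ id
    (strictMono_id.strictMonoOn _) ⟨g, hg, empty_isInitial g⟩ h
  exact ⟨L, fun a b hab => hL (by simp) (by simp) hab, fun u hu => hLu u hu (empty_isInitial u)⟩

/-- A finite set outside `F̂` need not have an initial segment in `F`, since its elements may be too
small; but the subsets of a sparse set `M'` do. If `v ∈ F̂` is not in `F`, then `v ∪ {b} ∈ F̂` for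
some `b` above `v`, and it suffices that each element of `M'` is at least the numbers `b` chosen for
all sets `v` of smaller elements of `M'`. -/
theorem exists_infinite_subset_forall_mem_hat_or_exists_isInitial {F : Set (Finset ℕ)}
    (hF : IsSpreading (hat F)) (hne : F.Nonempty) {M : Set ℕ} (hM : M.Infinite) :
    ∃ M' ⊆ M, M'.Infinite ∧
      ∀ u : Finset ℕ, (u : Set ℕ) ⊆ M' → u ∈ hat F ∨ ∃ p ∈ F, IsInitial p u := by
  have hb (v : Finset ℕ) : ∃ b, v ∈ hat F → v ∉ F → (∀ j ∈ v, j < b) ∧ insert b v ∈ hat F := by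
    by_cases hv : v ∈ hat F ∧ v ∉ F
    · obtain ⟨⟨s, hs, hvs⟩, hvF⟩ := hv
      obtain ⟨b, -, hb, hbs⟩ := IsProperInitial.exists_insert ⟨hvs, fun h => hvF (h ▸ hs)⟩
      exact ⟨b, fun _ _ => ⟨hb, s, hs, hbs⟩⟩
    · exact ⟨0, fun h₁ h₂ => absurd ⟨h₁, h₂⟩ hv⟩
  choose b hb using hb
  choose nxt hnxt hlt using fun N => hM.exists_gt N
  set H : ℕ → ℕ := fun k => ∑ v ∈ (Finset.range k).powerset, b v with hH
  have hbH {v : Finset ℕ} {k} (hv : v ⊆ Finset.range k) : b v ≤ H k :=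
    Finset.single_le_sum (fun _ _ => Nat.zero_le _) (Finset.mem_powerset.2 hv)
  obtain ⟨m, hm0, hm1⟩ : ∃ m : ℕ → ℕ, m 0 = nxt (H 0) ∧
      ∀ n, m (n + 1) = nxt (m n + H (m n + 1)) :=
    ⟨Nat.rec (nxt (H 0)) fun _ a => nxt (a + H (a + 1)), rfl, fun _ => rfl⟩
  have hmM (n) : m n ∈ M := by
    cases n with
    | zero => exact hm0 ▸ hnxt _
    | succ n => exact hm1 n ▸ hnxt _
  have hmono : StrictMono m := strictMono_nat_of_lt_succ fun n => by
    rw [hm1]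
    exact lt_of_le_of_lt (Nat.le_add_right _ _) (hlt _)
  have hbm {v : Finset ℕ} (hv : (v : Set ℕ) ⊆ Set.range m) {i} (hi : ∀ j ∈ v, j < m i) :
      b v ≤ m i := by
    cases i with
    | zero =>
      refine (hbH fun j hj => ?_).trans (hm0 ▸ (hlt _).le)
      obtain ⟨i, rfl⟩ := hv hj
      exact absurd (hmono.lt_iff_lt.1 (hi (m i) hj)) (Nat.not_lt_zero i)
    | succ n =>
      refine (hbH (k := m n + 1) fun j hj => ?_).trans
        ((Nat.le_add_left _ (m n)).trans (hm1 n ▸ (hlt _).le))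
      obtain ⟨i, rfl⟩ := hv hj
      have := hmono.lt_iff_lt.1 (hi (m i) hj)
      exact Finset.mem_range.2 (Nat.lt_succ_of_le (hmono.monotone (Nat.le_of_lt_succ this)))
  refine ⟨Set.range m, Set.range_subset_iff.2 hmM, Set.infinite_range_of_injective hmono.injective,
    fun u hu => ?_⟩
  classical
  -- The largest initial segment of `u` which belongs to `F̂`.
  obtain ⟨v, hv, hmax⟩ := Finset.exists_max_image
    (u.powerset.filter fun v => v ∈ hat F ∧ IsInitial v u) Finset.card
    ⟨∅, by
      obtain ⟨s, hs⟩ := hne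
      simp only [Finset.mem_filter, Finset.empty_mem_powerset, true_and]
      exact ⟨⟨s, hs, empty_isInitial s⟩, empty_isInitial u⟩⟩
  obtain ⟨-, hvF, hvu⟩ := Finset.mem_filter.1 hv
  by_cases heq : v = u
  · exact Or.inl (heq ▸ hvF)
  refine Or.inr ⟨v, by_contra fun hvF' => ?_, hvu⟩
  obtain ⟨a, hau, hav, hins⟩ := IsProperInitial.exists_insert ⟨hvu, heq⟩
  obtain ⟨hlt', hmem⟩ := hb v hvF hvF'
  obtain ⟨i, hi⟩ := hu hau
  have hle : b v ≤ a :=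
    hi ▸ hbm (fun j hj => hu (hvu.1 hj)) (fun j hj => hi.symm ▸ hav j hj)
  have := hmax (insert a v) (Finset.mem_filter.2
    ⟨Finset.mem_powerset.2 hins.1, hF.insert_mem hlt' hle hmem, hins⟩)
  rw [Finset.card_insert_of_notMem fun h => lt_irrefl a (hav a h)] at this
  omega

/-! ### Enumerations and plegma families -/

lemma pred_lt_card_toFinset {s : Finset ℕ} {k : ℕ} (hk : 1 ≤ k) (hks : k ≤ s.card)
    (hf : (Set.ofPred fun n => n ∈ (s : Set ℕ)).Finite) : k - 1 < hf.toFinset.card := by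
  have : hf.toFinset = s := by ext; simp
  rw [this]
  omega

lemma elt_image {p : Finset ℕ} {L : ℕ → ℕ} (hL : StrictMono L) {k : ℕ} (hk : 1 ≤ k)
    (hkp : k ≤ p.card) : elt ↑(p.image L) k = L (elt ↑p k) := by
  have h := Nat.nth_comp_of_strictMono (p := fun n => n ∈ (p.image L : Finset ℕ)) (n := k - 1) hL
    (fun n hn => by
      obtain ⟨a, -, rfl⟩ := Finset.mem_image.1 hn
      exact ⟨a, rfl⟩)
    (pred_lt_card_toFinset hk (by rwa [Finset.card_image_of_injective _ hL.injective]))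
  simp only [Finset.mem_image, hL.injective.eq_iff, exists_eq_right] at h
  simpa [elt] using h.symm

lemma elt_image_of_infinite {M : Set ℕ} (hM : M.Infinite) {L : ℕ → ℕ} (hL : StrictMono L) (k : ℕ) :
    elt (L '' M) k = L (elt M k) := by
  have h := Nat.nth_comp_of_strictMono (p := fun n => n ∈ L '' M) (n := k - 1) hL
    (fun n hn => Set.image_subset_range L M hn)
    (fun hf => absurd hf (hM.image hL.injective.injOn))
  simp only [hL.injective.mem_set_image] at h
  exact h.symm

lemma elt_eq_of_isInitial {s t : Finset ℕ} (h : IsInitial s t) {k : ℕ} (hk : 1 ≤ k)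
    (hks : k ≤ s.card) : elt ↑s k = elt ↑t k := by
  classical
  have hfin := pred_lt_card_toFinset hk hks
  have hmem : elt ↑s k ∈ s := Nat.nth_mem (p := fun n => n ∈ (s : Set ℕ)) (k - 1) hfin
  have hcount : Nat.count (fun n => n ∈ (s : Set ℕ)) (elt ↑s k) = k - 1 := Nat.count_nth hfin
  have hst : Nat.count (fun n => n ∈ (t : Set ℕ)) (elt ↑s k) = k - 1 := by
    rw [← hcount]
    exact le_antisymm (Nat.count_mono_left fun j hj hjt => h.2 j hjt _ hmem hj.le)
      (Nat.count_mono_left fun j _ hjs => h.1 hjs)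
  have := Nat.nth_count (p := fun n => n ∈ (t : Set ℕ)) (h.1 hmem : elt ↑s k ∈ t)
  rw [hst] at this
  exact this.symm

lemma elt_le_elt_of_subset {M M' : Set ℕ} (hM' : M'.Infinite) (h : M' ⊆ M) (k : ℕ) :
    elt M k ≤ elt M' k := by
  classical
  have hM : M.Infinite := hM'.mono h
  refine (Nat.count_le_iff_le_nth (p := fun n => n ∈ M') hM').1 ?_
  calc Nat.count (fun n => n ∈ M') (elt M k) ≤ Nat.count (fun n => n ∈ M) (elt M k) :=
        Nat.count_mono_left fun j _ hj => h hj
    _ = k - 1 := Nat.count_nth fun hf => absurd hf hM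

lemma IsPlegma.of_isInitial_image {l : ℕ} {p t : Fin l → Finset ℕ} {L : ℕ → ℕ} (hL : StrictMono L)
    (ht : IsPlegma t) (hp : ∀ i, (p i).Nonempty) (h : ∀ i, IsInitial ((p i).image L) (t i)) :
    IsPlegma p := by
  have hcard (i) : ((p i).image L).card = (p i).card :=
    Finset.card_image_of_injective _ hL.injective
  have hle (i) : (p i).card ≤ (t i).card := hcard i ▸ Finset.card_le_card (h i).1
  have key (i) {k} (hk : 1 ≤ k) (hki : k ≤ (p i).card) : elt ↑(t i) k = L (elt ↑(p i) k) := by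
    rw [← elt_eq_of_isInitial (h i) hk (by rwa [hcard]), elt_image hL hk hki]
  refine ⟨hp, fun i j hij k hk hki hkj => hL.lt_iff_lt.1 ?_,
    fun i j k hk hki hkj => hL.lt_iff_lt.1 ?_⟩
  · rw [← key i hk hki, ← key j hk hkj]
    exact ht.2.1 i j hij k hk (hki.trans (hle i)) (hkj.trans (hle j))
  · rw [← key i hk hki, ← key j (by omega) hkj]
    exact ht.2.2 i j k hk (hki.trans (hle i)) (hkj.trans (hle j))

/-! ### Transfer of spreading models -/

/-- If `L` embeds `F̂` into `Ĝ`, then a member of `G` inside `L '' M'` cannot be the image of a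
proper initial segment of a member of `F`, as `G` is thin; so its preimage has an initial segment
in `F`. -/
lemma exists_isInitial_image_of_subset {F G : Set (Finset ℕ)} (hG : IsThin G) {M' : Set ℕ}
    (hM' : ∀ u : Finset ℕ, (u : Set ℕ) ⊆ M' → u ∈ hat F ∨ ∃ p ∈ F, IsInitial p u) {L : ℕ → ℕ}
    (hL : StrictMono L) (hLG : ∀ u ∈ hat F, u.image L ∈ hat G) {t : Finset ℕ} (ht : t ∈ G)
    (htM : (t : Set ℕ) ⊆ L '' M') : ∃ p ∈ F, IsInitial (p.image L) t := by
  obtain ⟨u, hu, rfl⟩ := Finset.subset_set_image_iff.1 htM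
  obtain ⟨v, hv, huv⟩ | ⟨p, hp, hpu⟩ := hM' u hu
  · obtain ⟨g, hg, hvg⟩ := hLG v (subset_hat F hv)
    have huv' := huv.image hL
    obtain rfl := hG.eq_of_isInitial ht hg (huv'.trans hvg)
    exact ⟨v, hv, hvg⟩
  · exact ⟨p, hp, hpu.image hL⟩

section

variable {X : Type u} [NormedAddCommGroup X] [NormedSpace ℝ X]
  {E : Type v} [SeminormedAddCommGroup E] [NormedSpace ℝ E]

theorem Admits.exists_of_familyOrder_le {F G : Set (Finset ℕ)} (hF : IsRegularThin F)
    (hG : IsRegularThin G) (h₁ : 1 ≤ familyOrder F) (hFG : familyOrder F ≤ familyOrder G)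
    {x : F → X} {e : Module.Basis ℕ ℝ E} (hx : Admits x e) :
    ∃ w : G → X, Set.range w ⊆ Set.range x ∧ Admits w e := by
  obtain ⟨hFne, hF0⟩ := nonempty_of_one_le_familyOrder hF h₁
  obtain ⟨hGne, -⟩ := nonempty_of_one_le_familyOrder hG (h₁.trans hFG)
  obtain ⟨L, hL, hLG⟩ := exists_strictMono_image_mem_hat hF hG hGne hFG
  obtain ⟨M, hM, δ, hδ, hδ0, hgen⟩ := hx
  obtain ⟨M', hM'M, hM'inf, hM'⟩ :=
    exists_infinite_subset_forall_mem_hat_or_exists_isInitial hF.2.2.2 hFne hM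
  have hφ (t : G) : ∃ p : F, ((t : Finset ℕ) : Set ℕ) ⊆ L '' M' →
      IsInitial ((p : Finset ℕ).image L) t := by
    by_cases htM : ((t : Finset ℕ) : Set ℕ) ⊆ L '' M'
    · obtain ⟨p, hp, hpt⟩ := exists_isInitial_image_of_subset hG.1 hM' hL hLG t.2 htM
      exact ⟨⟨p, hp⟩, fun _ => hpt⟩
    · exact ⟨⟨hFne.some, hFne.some_mem⟩, fun h => absurd h htM⟩
  choose φ hφ using hφ
  refine ⟨fun t => x (φ t), fun _ ⟨t, ht⟩ => ⟨φ t, ht⟩, L '' M', hM'inf.image hL.injective.injOn,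
    δ, hδ, hδ0, fun l k hk hkl a ha t htM htp ht₁ => ?_⟩
  have hsub (j) {n} (hn : n ∈ (φ (t j) : Finset ℕ)) : L n ∈ (t j : Finset ℕ) :=
    (hφ (t j) (htM j)).1 (Finset.mem_image_of_mem L hn)
  refine hgen l k hk hkl a ha (fun j => φ (t j)) (fun j n hn => hM'M ?_) ?_ (fun n hn => ?_)
  · obtain ⟨m, hm, hmn⟩ := htM j (hsub j hn)
    exact hL.injective hmn ▸ hm
  · exact htp.of_isInitial_image hL
      (fun i => Finset.nonempty_iff_ne_empty.2 fun h => hF0 (h ▸ (φ (t i)).2))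
      fun i => hφ (t i) (htM i)
  · have := ht₁ (L n) (hsub _ hn)
    rw [elt_image_of_infinite hM'inf hL, hL.le_iff_le] at this
    exact (elt_le_elt_of_subset hM'inf hM'M l).trans this

theorem IsSpreadingModelOf.of_familyOrder_le {F G : Set (Finset ℕ)} (hF : IsRegularThin F)
    (hG : IsRegularThin G) (h₁ : 1 ≤ familyOrder F) (hFG : familyOrder F ≤ familyOrder G)
    {A : Set X} {e : Module.Basis ℕ ℝ E} (h : IsSpreadingModelOf F A e) :
    IsSpreadingModelOf G A e := by
  obtain ⟨x, hxA, hx⟩ := h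
  obtain ⟨w, hwx, hw⟩ := hx.exists_of_familyOrder_le hF hG h₁ hFG
  refine ⟨w, fun t => ?_, hw⟩
  obtain ⟨s, hs⟩ := hwx ⟨t, rfl⟩
  exact hs ▸ hxA s

end

/-! ### Regular thin families of prescribed order -/

/-- A well-founded hereditary family is compact: its members agree with a limit set `T` on
arbitrarily long initial intervals, so the finite initial segments of `T` are in the family, and `T`
must be finite. -/
lemma IsHereditary.isCompactFamily {R : Set (Finset ℕ)} (hR : IsHereditary R)
    (hwf : WellFounded fun t s : Finset ℕ => t ∈ R ∧ IsProperInitial s t) : IsCompactFamily R := by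
  classical
  refine isClosed_of_closure_subset fun T hT => ?_
  have happrox (n : ℕ) : (Finset.range n).filter (fun k => T k = true) ∈ R := by
    have hopen : IsOpen {U : ℕ → Bool | ∀ k ∈ Finset.range n, U k = T k} := by
      have : {U : ℕ → Bool | ∀ k ∈ Finset.range n, U k = T k} =
          ⋂ k ∈ Finset.range n, (fun U : ℕ → Bool => U k) ⁻¹' {T k} := by ext; simp
      rw [this]
      exact isOpen_biInter_finset fun k _ => (isOpen_discrete _).preimage (continuous_apply k)
    obtain ⟨_, hU, s, hs, rfl⟩ := mem_closure_iff.1 hT _ hopen fun _ _ => rfl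
    refine hR s hs _ fun k hk => ?_
    obtain ⟨hkn, hkT⟩ := Finset.mem_filter.1 hk
    simpa [hkT] using hU k hkn
  by_cases hfin : {k | T k = true}.Finite
  · obtain ⟨n, hn⟩ := hfin.bddAbove
    refine ⟨_, happrox (n + 1), funext fun k => ?_⟩
    rw [Bool.eq_iff_iff, decide_eq_true_eq, Finset.mem_filter, Finset.mem_range]
    exact ⟨fun h => h.2, fun h => ⟨Nat.lt_succ_of_le (hn h), h⟩⟩
  · -- Enumerating the infinite set `T` gives an infinite increasing chain.
    exfalso
    have hinf : (Set.ofPred fun k => T k = true).Infinite := hfin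
    refine (wellFounded_iff_isEmpty_descending_chain.1 hwf).elim
      ⟨fun n => (Finset.range (Nat.nth (fun k => T k = true) n)).filter fun k => T k = true,
        fun n => ⟨happrox _, ⟨fun k hk => ?_, fun a ha b hb hab => ?_⟩, fun he => ?_⟩⟩
    · simp only [Finset.mem_filter, Finset.mem_range] at hk ⊢
      exact ⟨hk.1.trans (Nat.nth_strictMono hinf n.lt_succ_self), hk.2⟩
    · simp only [Finset.mem_filter, Finset.mem_range] at ha hb ⊢
      exact ⟨hab.trans_lt hb.1, ha.2⟩
    · have : Nat.nth (fun k => T k = true) n ∈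
          (Finset.range (Nat.nth (fun k => T k = true) (n + 1))).filter fun k => T k = true :=
        Finset.mem_filter.2 ⟨Finset.mem_range.2 (Nat.nth_strictMono hinf n.lt_succ_self),
          Nat.nth_mem_of_infinite hinf n⟩
      beta_reduce at he
      rw [← he] at this
      simp at this

/-- The `⊑`-maximal members of a family. -/
def maximalMembers (R : Set (Finset ℕ)) : Set (Finset ℕ) :=
  {s ∈ R | ∀ t ∈ R, ¬ IsProperInitial s t}

lemma isThin_maximalMembers (R : Set (Finset ℕ)) : IsThin (maximalMembers R) :=
  fun _ hs t ht => hs.2 t ht.1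

lemma hat_maximalMembers {R : Set (Finset ℕ)} (hR : IsHereditary R)
    (hwf : WellFounded fun t s : Finset ℕ => t ∈ R ∧ IsProperInitial s t) :
    hat (maximalMembers R) = R := by
  refine Set.Subset.antisymm (fun t ⟨s, hs, hts⟩ => hR s hs.1 t hts.1) fun s => ?_
  induction s using hwf.induction with
  | _ s ih =>
  intro hs
  by_cases hmax : ∀ t ∈ R, ¬ IsProperInitial s t
  · exact ⟨s, ⟨hs, hmax⟩, .refl s⟩
  · push Not at hmax
    obtain ⟨t, ht, hst⟩ := hmax
    exact mem_hat_of_isInitial (ih t ⟨ht, hst⟩ ht) hst.1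

/-- `α` is a strictly decreasing assignment of ordinals below `ξ` to the elements of `s`, such that
the ordinal assigned to `n` has code at most `n`. -/
def IsLabelling (code : Ordinal.{0} → ℕ) (ξ : Ordinal.{0}) (s : Finset ℕ)
    (α : ℕ → Ordinal.{0}) : Prop :=
  StrictAntiOn α ↑s ∧ ∀ n ∈ s, α n < ξ ∧ code (α n) ≤ n

/-- The finite sets which have a labelling. When `code` is injective on the ordinals below `ξ`, this
is a regular family of order `ξ`. -/
def labelled (code : Ordinal.{0} → ℕ) (ξ : Ordinal.{0}) : Set (Finset ℕ) :=
  {s | ∃ α, IsLabelling code ξ s α}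

/-- The ordinals `β ≤ ξ` which are at most the label of each element of `s`, for some labelling of
`s`. If this set is nonempty, its greatest element is the rank of `s` in `labelled code ξ`. -/
def labelBounds (code : Ordinal.{0} → ℕ) (ξ : Ordinal.{0}) (s : Finset ℕ) : Set Ordinal.{0} :=
  {β | β ≤ ξ ∧ ∃ α, IsLabelling code ξ s α ∧ ∀ n ∈ s, β ≤ α n}

section Labelled

variable {code : Ordinal.{0} → ℕ} {ξ : Ordinal.{0}}

lemma IsLabelling.mono {s t : Finset ℕ} {α : ℕ → Ordinal.{0}} (h : IsLabelling code ξ s α)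
    (hts : t ⊆ s) : IsLabelling code ξ t α :=
  ⟨h.1.mono hts, fun n hn => h.2 n (hts hn)⟩

lemma isHereditary_labelled : IsHereditary (labelled code ξ) :=
  fun _ ⟨α, hα⟩ _ hts => ⟨α, hα.mono hts⟩

lemma isSpreading_labelled : IsSpreading (labelled code ξ) := by
  rintro k n m hn hm hnm ⟨α, hα⟩
  have hmem (i) : n i ∈ Finset.univ.image n := Finset.mem_image_of_mem n (Finset.mem_univ i)
  have hext (i) : Function.extend m (α ∘ n) 0 (m i) = α (n i) := hm.injective.extend_apply _ _ i
  refine ⟨Function.extend m (α ∘ n) 0, ?_, ?_⟩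
  · intro a ha b hb hab
    obtain ⟨i, -, rfl⟩ := Finset.mem_image.1 ha
    obtain ⟨j, -, rfl⟩ := Finset.mem_image.1 hb
    rw [hext, hext]
    exact hα.1 (hmem i) (hmem j) (hn (hm.lt_iff_lt.1 hab))
  · intro a ha
    obtain ⟨i, -, rfl⟩ := Finset.mem_image.1 ha
    rw [hext]
    exact ⟨(hα.2 _ (hmem i)).1, (hα.2 _ (hmem i)).2.trans (hnm i)⟩

/-- Only finitely many ordinals below `ξ` have code at most `max s`, and the label of `max s` is one
of them. -/
lemma exists_isGreatest_labelBounds (hcode : Set.InjOn code (Set.Iio ξ)) {s : Finset ℕ}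
    (hs : s ∈ labelled code ξ) : ∃ β, IsGreatest (labelBounds code ξ s) β := by
  obtain rfl | hne := s.eq_empty_or_nonempty
  · obtain ⟨α, hα⟩ := hs
    exact ⟨ξ, ⟨le_rfl, α, hα, by simp⟩, fun β hβ => hβ.1⟩
  set m := s.max' hne
  have hm : m ∈ s := s.max'_mem hne
  have hfin : {γ | ∃ α, IsLabelling code ξ s α ∧ α m = γ}.Finite := by
    refine Set.Finite.of_finite_image (f := code)
      ((Set.finite_Iic m).subset ?_) (hcode.mono ?_)
    · rintro _ ⟨_, ⟨α, hα, rfl⟩, rfl⟩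
      exact (hα.2 m hm).2
    · rintro _ ⟨α, hα, rfl⟩
      exact (hα.2 m hm).1
  obtain ⟨α₀, hα₀⟩ := hs
  obtain ⟨_, ⟨α, hα, rfl⟩, hmax⟩ := Set.exists_max_image _ id hfin ⟨_, α₀, hα₀, rfl⟩
  refine ⟨α m, ⟨(hα.2 m hm).1.le, α, hα, fun n hn =>
    hα.1.antitoneOn hn hm (s.le_max' n hn)⟩, ?_⟩
  rintro β ⟨-, α', hα', hβ⟩
  exact (hβ m hm).trans (hmax _ ⟨α', hα', rfl⟩)

lemma exists_lt_of_mem_labelBounds {s t : Finset ℕ} (hst : IsProperInitial s t) {β : Ordinal.{0}}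
    (hβ : β ∈ labelBounds code ξ t) : ∃ γ ∈ labelBounds code ξ s, β < γ := by
  obtain ⟨-, α, hα, hβα⟩ := hβ
  obtain ⟨n, hn, hlt, -⟩ := hst.exists_insert
  exact ⟨Order.succ β, ⟨Order.succ_le_of_lt ((hβα n hn).trans_lt (hα.2 n hn).1), α,
    hα.mono hst.1.1, fun j hj =>
      Order.succ_le_of_lt ((hβα n hn).trans_lt (hα.1 (hst.1.1 hj) hn (hlt j hj)))⟩,
    Order.lt_succ β⟩

lemma csSup_labelBounds_lt (hcode : Set.InjOn code (Set.Iio ξ)) {s t : Finset ℕ}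
    (ht : t ∈ labelled code ξ) (hst : IsProperInitial s t) :
    sSup (labelBounds code ξ t) < sSup (labelBounds code ξ s) := by
  obtain ⟨β, hβ⟩ := exists_isGreatest_labelBounds hcode ht
  obtain ⟨γ, hγ⟩ := exists_isGreatest_labelBounds hcode (isHereditary_labelled t ht s hst.1.1)
  rw [hβ.csSup_eq, hγ.csSup_eq]
  obtain ⟨δ, hδ, hlt⟩ := exists_lt_of_mem_labelBounds hst hβ.1
  exact hlt.trans_le (hγ.2 hδ)

lemma wellFounded_labelled (hcode : Set.InjOn code (Set.Iio ξ)) :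
    WellFounded fun t s : Finset ℕ => t ∈ labelled code ξ ∧ IsProperInitial s t :=
  Subrelation.wf (fun h => csSup_labelBounds_lt hcode h.1 h.2)
    (InvImage.wf (fun s => sSup (labelBounds code ξ s)) Ordinal.lt_wf)

lemma le_rank_of_mem_labelBounds {F : Set (Finset ℕ)} (hF : hat F = labelled code ξ)
    (hwf : WellFounded (Extends F)) (β : Ordinal.{0}) :
    ∀ s, β ∈ labelBounds code ξ s → β ≤ (hwf.apply s).rank := by
  induction β using WellFoundedLT.induction with
  | _ β ih =>
  rintro s ⟨hβξ, α, hα, hβ⟩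
  refine le_of_forall_lt fun γ hγ => ?_
  -- Give the label `γ` to a new element beyond `s` and beyond the code of `γ`.
  set n := max (s.sup id + 1) (code γ) with hn
  have hsn : ∀ j ∈ s, j < n := fun j hj =>
    (Nat.lt_succ_of_le (Finset.le_sup (f := id) hj)).trans_le (le_max_left _ _)
  have hns : n ∉ s := fun h => lt_irrefl n (hsn n h)
  have heq : Set.EqOn (Function.update α n γ) α ↑s := fun j hj =>
    Function.update_of_ne (ne_of_mem_of_not_mem hj hns) _ _
  have hlab : IsLabelling code ξ (insert n s) (Function.update α n γ) := by
    refine ⟨fun i hi j hj hij => ?_, fun i hi => ?_⟩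
    · simp only [Finset.coe_insert, Set.mem_insert_iff, Finset.mem_coe] at hi hj
      rcases hi with rfl | hi <;> rcases hj with rfl | hj
      · exact absurd hij (lt_irrefl _)
      · exact absurd (hsn j hj) (not_lt.2 hij.le)
      · rw [heq hi, Function.update_self]
        exact hγ.trans_le (hβ i hi)
      · rw [heq hi, heq hj]
        exact hα.1 hi hj hij
    · rcases Finset.mem_insert.1 hi with rfl | hi
      · rw [Function.update_self]
        exact ⟨hγ.trans_le hβξ, le_max_right _ _⟩
      · rw [heq hi]
        exact hα.2 i hi
  have hγ' : γ ∈ labelBounds code ξ (insert n s) := by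
    refine ⟨(hγ.trans_le hβξ).le, _, hlab, fun i hi => ?_⟩
    rcases Finset.mem_insert.1 hi with rfl | hi
    · rw [Function.update_self]
    · rw [heq hi]
      exact hγ.le.trans (hβ i hi)
  exact (ih γ hγ _ hγ').trans_lt
    (rank_lt_rank hwf ⟨hF ▸ ⟨_, hlab⟩, isProperInitial_insert hsn⟩)

lemma rank_le_csSup_labelBounds {F : Set (Finset ℕ)} (hF : hat F = labelled code ξ)
    (hcode : Set.InjOn code (Set.Iio ξ)) (hwf : WellFounded (Extends F)) (s : Finset ℕ) :
    (hwf.apply s).rank ≤ sSup (labelBounds code ξ s) := by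
  induction s using hwf.induction with
  | _ s ih =>
  exact rank_le_of_forall_lt hwf fun t ht =>
    (ih t ht).trans_lt (csSup_labelBounds_lt hcode (hF ▸ ht.1) ht.2)

end Labelled

theorem exists_isRegularThin_familyOrder_eq {ξ : Ordinal.{0}} (hξ : ξ < Ordinal.omega 1) :
    ∃ F : Set (Finset ℕ), IsRegularThin F ∧ familyOrder F = ξ := by
  have hcount : (Set.Iio ξ).Countable := by
    rw [← Cardinal.le_aleph0_iff_set_countable, Cardinal.mk_Iio_ordinal, Cardinal.lift_le_aleph0,
      ← Cardinal.lt_aleph_one_iff, ← Cardinal.lt_ord, Cardinal.ord_aleph]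
    exact hξ
  obtain ⟨code, hcode⟩ := Set.countable_iff_exists_injOn.1 hcount
  have hwf := wellFounded_labelled hcode
  have hhat := hat_maximalMembers isHereditary_labelled hwf
  have hreg : IsRegularThin (maximalMembers (labelled code ξ)) :=
    ⟨isThin_maximalMembers _, by
      rw [hhat]
      exact ⟨isHereditary_labelled.isCompactFamily hwf, isHereditary_labelled,
        isSpreading_labelled⟩⟩
  have hwf' := hreg.2.1.wellFounded_extends
  have hmem : ξ ∈ labelBounds code ξ ∅ := ⟨le_rfl, 0, ⟨by simp [StrictAntiOn], by simp⟩, by simp⟩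
  refine ⟨_, hreg, ?_⟩
  rw [familyOrder_eq_rank hwf']
  exact le_antisymm ((rank_le_csSup_labelBounds hhat hcode hwf' ∅).trans
    (csSup_le ⟨ξ, hmem⟩ fun β hβ => hβ.1)) (le_rank_of_mem_labelBounds hhat hwf' ξ ∅ hmem)

end PlegmaSpreading

theorem lemma4p8 {X : Type u} [NormedAddCommGroup X] [NormedSpace ℝ X] [CompleteSpace X] :
    (∀ F G : Set (Finset ℕ), IsRegularThin F → IsRegularThin G →
      1 ≤ familyOrder F → familyOrder F ≤ familyOrder G →
      ∀ (x : F → X) (E : Type v) [SeminormedAddCommGroup E] [NormedSpace ℝ E]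
        (e : Module.Basis ℕ ℝ E), Admits x e →
        ∃ w : G → X, Set.range w ⊆ Set.range x ∧ Admits w e) ∧
    (∀ F G : Set (Finset ℕ), IsRegularThin F → IsRegularThin G → F.Nonempty → G.Nonempty →
      familyOrder F = familyOrder G →
      ∀ (A : Set X) (E : Type v) [SeminormedAddCommGroup E] [NormedSpace ℝ E]
        (e : Module.Basis ℕ ℝ E), IsSpreadingModelOf F A e ↔ IsSpreadingModelOf G A e) ∧
    (∀ (A : Set X) (ζ ξ : Ordinal.{0}), 1 ≤ ζ → ζ < ξ → ξ < Ordinal.omega 1 →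
      (SM ζ A : Set BasisSequence.{v}) ⊆ SM ξ A) := by
  refine ⟨fun F G hF hG h₁ hFG x E _ _ e hx => hx.exists_of_familyOrder_le hF hG h₁ hFG,
    fun F G hF hG hFne hGne hFG A E _ _ e => ?_, ?_⟩
  · rcases eq_or_ne (familyOrder F) 0 with h0 | h0
    · rw [eq_singleton_of_familyOrder_eq_zero hF hFne h0,
        eq_singleton_of_familyOrder_eq_zero hG hGne (hFG ▸ h0)]
    · have h₁ : 1 ≤ familyOrder F := Order.one_le_iff_pos.2 (pos_iff_ne_zero.2 h0)
      exact ⟨fun h => h.of_familyOrder_le hF hG h₁ hFG.le,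
        fun h => h.of_familyOrder_le hG hF (hFG ▸ h₁) hFG.ge⟩
  · rintro A ζ ξ hζ hζξ hξ e ⟨F, hF, rfl, he⟩
    obtain ⟨G, hG, rfl⟩ := exists_isRegularThin_familyOrder_eq hξ
    exact ⟨G, hG, rfl, he.of_familyOrder_le hF hG hζ hζξ.le⟩
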